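/- Let $H$ be a (real or complex) Hilbert space and let $T$ be a (possibly unbounded) self-adjoint operator on $H$ that is positive definite, i.e. $(Tf,f)>0$ for all $0\neq f\in D(T)$. Let $E$ be the spectral measure of $T$ on $(0,\infty)$: a resolution of the identity by orthogonal projections on the Borel subsets of $(0,\infty)$ such that, with $E_{f,g}(A)=(E(A)f,g)$, one has $(Tf,g)=\int_0^\infty\lambda\,dE_{f,g}(\lambda)$ for all $f\in D(T)$, $g\in H$. An index function is a measurable function $(0,\infty)\to(0,\infty)$; sums, products and the order of index functions are pointwise. For an index function $w$ let $H_w$ be the Hilbert space obtained by completing $\{f\in H:\int_0^\infty w\,dE_{f,f}<\infty\}$ for the norm $\|f\|_w=\bigl(\int_0^\infty w\,dE_{f,f}\bigr)^{1/2}$. If $v\le w$, then the inclusion of the domains extends to a continuous map $H_w\to H_v$, and for $f\in H_w$ we write $\|f\|_v$ for the norm in $H_v$ of the image of $f$. Let $\varphi,\psi,\theta$ be index functions. (i) Suppose that $\psi$ is injective, with inverse $\psi^{-1}:\psi((0,\infty))\to(0,\infty)$, and that $\varphi\circ\psi^{-1}$ is concave on $\psi((0,\infty))$ (so that $\psi((0,\infty))$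 is an interval). Then for every $f\in H_{(\varphi+\psi+1)\theta}$ with $f\ne0$ one has $\|f\|_\theta>0$, $\|f\|_{\psi\theta}^2/\|f\|_\theta^2\in\psi((0,\infty))$, and $$\|f\|_{\varphi\theta}^2\le\|f\|_\theta^2\;\varphi\circ\psi^{-1}\!\left(\frac{\|f\|_{\psi\theta}^2}{\|f\|_\theta^2}\right).$$ (ii) Suppose that $\varphi$ and $\psi$ are strictly increasing and that $\psi\circ\varphi^{-1}$ is convex on $\varphi((0,\infty))$ (so that $\varphi((0,\infty))$ is an interval). Then for every $f\in H_{(\varphi+\psi+1)\theta}$ with $f\ne0$ one has $\|f\|_\theta>0$, $\|f\|_{\varphi\theta}^2/\|f\|_\theta^2\in\varphi((0,\infty))$, $\|f\|_{\psi\theta}^2/\|f\|_\theta^2\in\psi((0,\infty))$, and $$\varphi^{-1}\!\left(\frac{\|f\|_{\varphi\theta}^2}{\|f\|_\theta^2}\right)\le\psi^{-1}\!\left(\frac{\|f\|_{\psi\theta}^2}{\|f\|_\theta^2}\right).$$ -/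

import Mathlib

open MeasureTheory
open scoped ENNReal

/-- The open half-line `(0, ∞)`, with its Borel structure. -/
abbrev PosReal : Type := {x : ℝ // 0 < x}

/-! ### Index functions -/

/-- An index function: a measurable function `(0, ∞) → (0, ∞)`. -/
structure IndexFunction where
  toFun : PosReal → PosReal
  measurable_toFun : Measurable toFun

namespace IndexFunction

instance : CoeFun IndexFunction (fun _ => PosReal → PosReal) := ⟨toFun⟩

/-- Pointwise sum. -/
instance : Add IndexFunction where
  add φ ψ := ⟨fun x => φ x + ψ x, Measurable.subtype_mk
    ((measurable_subtype_coe.comp φ.measurable_toFun).add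
      (measurable_subtype_coe.comp ψ.measurable_toFun))⟩

/-- Pointwise product. -/
instance : Mul IndexFunction where
  mul φ ψ := ⟨fun x => φ x * ψ x, Measurable.subtype_mk
    ((measurable_subtype_coe.comp φ.measurable_toFun).mul
      (measurable_subtype_coe.comp ψ.measurable_toFun))⟩

/-- The constant index function `1`. -/
instance : One IndexFunction where
  one := ⟨fun _ => 1, measurable_const⟩

/-- Pointwise order. -/
instance : LE IndexFunction where
  le φ ψ := ∀ x, φ x ≤ ψ x

/-- The range of an index function, as a set of real numbers. -/
def range (φ : IndexFunction) : Set ℝ := Set.range fun x : PosReal => (φ x : ℝ)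

/-- The inverse `φ⁻¹` of an injective index function; it is meaningful on `φ.range` only. -/
noncomputable def inv (φ : IndexFunction) : ℝ → PosReal :=
  @Function.invFun PosReal ℝ ⟨1⟩ fun x => (φ x : ℝ)

/-- On the range of an injective `φ`, `φ.inv` is the two-sided inverse. -/
theorem inv_apply {φ : IndexFunction} (hφ : Function.Injective φ) (x : PosReal) :
    φ.inv (φ x) = x :=
  @Function.leftInverse_invFun PosReal ℝ ⟨1⟩ _ (Subtype.coe_injective.comp hφ) x

theorem apply_inv {φ : IndexFunction} {y : ℝ} (hy : y ∈ φ.range) : (φ (φ.inv y) : ℝ) = y :=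
  @Function.invFun_eq PosReal ℝ ⟨1⟩ (fun x => (φ x : ℝ)) y hy

theorem le_weight_left (φ ψ θ : IndexFunction) : φ * θ ≤ (φ + ψ + 1) * θ := by
  intro x
  change ((φ x : ℝ) * θ x) ≤ ((φ x : ℝ) + ψ x + 1) * θ x
  have h1 := (φ x).2
  have h2 := (ψ x).2
  have h3 := (θ x).2
  gcongr
  linarith

theorem le_weight_right (φ ψ θ : IndexFunction) : ψ * θ ≤ (φ + ψ + 1) * θ := by
  intro x
  change ((ψ x : ℝ) * θ x) ≤ ((φ x : ℝ) + ψ x + 1) * θ x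
  have h1 := (φ x).2
  have h2 := (ψ x).2
  have h3 := (θ x).2
  gcongr
  linarith

theorem le_weight_base (φ ψ θ : IndexFunction) : θ ≤ (φ + ψ + 1) * θ := by
  intro x
  change (θ x : ℝ) ≤ ((φ x : ℝ) + ψ x + 1) * θ x
  have h1 := (φ x).2
  have h2 := (ψ x).2
  have h3 := (θ x).2
  nlinarith [mul_pos h1 h3, mul_pos h2 h3]

end IndexFunction

/-! ### Spectral measures -/

/-- A resolution of the identity on the Borel sets of `(0, ∞)`, with values in the orthogonal
projections of the Hilbert space `H`.  The spectral family is `E(t) = proj {x | x ≤ t}`. -/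
structure SpectralMeasure (𝕜 H : Type*) [RCLike 𝕜] [NormedAddCommGroup H]
    [InnerProductSpace 𝕜 H] [CompleteSpace H] where
  proj : Set PosReal → H →L[𝕜] H
  isStarProjection_proj : ∀ A, MeasurableSet A → IsStarProjection (proj A)
  proj_univ : proj Set.univ = 1
  proj_inter : ∀ A B, MeasurableSet A → MeasurableSet B → proj (A ∩ B) = proj A * proj B
  hasSum_proj : ∀ A : ℕ → Set PosReal, (∀ n, MeasurableSet (A n)) →
    Pairwise (Function.onFun Disjoint A) →
    ∀ f : H, HasSum (fun n => proj (A n) f) (proj (⋃ n, A n) f)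

namespace SpectralMeasure

variable {𝕜 H : Type*} [RCLike 𝕜] [NormedAddCommGroup H] [InnerProductSpace 𝕜 H]
  [CompleteSpace H]

theorem proj_empty (E : SpectralMeasure 𝕜 H) (f : H) : E.proj ∅ f = 0 := by
  have h := E.hasSum_proj (fun _ => ∅) (fun _ => MeasurableSet.empty)
    (fun _ _ _ => by simp [Function.onFun]) f
  exact (summable_const_iff (β := ℕ) _).1 h.summable

theorem inner_proj_self (E : SpectralMeasure 𝕜 H) (f : H) {A : Set PosReal}
    (hA : MeasurableSet A) : RCLike.re (inner 𝕜 f (E.proj A f)) = ‖E.proj A f‖ ^ 2 := by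
  have h := E.isStarProjection_proj A hA
  have hi : E.proj A (E.proj A f) = E.proj A f := by
    have := congrArg (fun S : H →L[𝕜] H => S f) h.isIdempotentElem.eq
    simpa using this
  have hs : inner 𝕜 f (E.proj A (E.proj A f)) = inner 𝕜 (E.proj A f) (E.proj A f) := by
    have := (ContinuousLinearMap.isSelfAdjoint_iff_isSymmetric.1 h.isSelfAdjoint)
      f (E.proj A f)
    exact this.symm
  rw [hi] at hs
  rw [hs, inner_self_eq_norm_sq]

open Classical in
/-- The scalar spectral measure `E_{f,g}`, with `E_{f,g}(A) = (E(A) f, g)`, where `(·,·)` is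
linear in its first argument. -/
noncomputable def scalar (E : SpectralMeasure 𝕜 H) (f g : H) : VectorMeasure PosReal 𝕜 where
  measureOf' A := if MeasurableSet A then inner 𝕜 g (E.proj A f) else 0
  empty' := by simp [E.proj_empty]
  not_measurable' A hA := by simp [hA]
  m_iUnion' A hA hd := by
    simp only [hA, MeasurableSet.iUnion hA, if_true]
    exact (E.hasSum_proj A hA hd f).mapL (innerSL 𝕜 g)

/-- The positive measure `E_{f,f}`, with `E_{f,f}(A) = (E(A) f, f)`. -/
noncomputable def measure (E : SpectralMeasure 𝕜 H) (f : H) : Measure PosReal :=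
  Measure.ofMeasurable (fun A _ => ENNReal.ofReal (RCLike.re (inner 𝕜 f (E.proj A f))))
    (by simp [E.proj_empty])
    (by
      intro A hA hd
      have h : HasSum (fun n => RCLike.re (inner 𝕜 f (E.proj (A n) f)))
          (RCLike.re (inner 𝕜 f (E.proj (⋃ n, A n) f))) :=
        ((E.hasSum_proj A hA hd f).mapL (innerSL 𝕜 f)).mapL RCLike.reCLM
      rw [← h.tsum_eq]
      refine ENNReal.ofReal_tsum_of_nonneg (fun n => ?_) h.summable
      rw [E.inner_proj_self f (hA n)]
      positivity)

theorem measure_apply (E : SpectralMeasure 𝕜 H) (f : H) {A : Set PosReal}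
    (hA : MeasurableSet A) : E.measure f A = ‖E.proj A f‖ₑ ^ 2 := by
  rw [measure, Measure.ofMeasurable_apply _ hA, E.inner_proj_self f hA,
    ENNReal.ofReal_pow (norm_nonneg _), ofReal_norm]

theorem scalar_apply (E : SpectralMeasure 𝕜 H) (f g : H) {A : Set PosReal}
    (hA : MeasurableSet A) : E.scalar f g A = inner 𝕜 g (E.proj A f) :=
  if_pos hA

/-- `E` is the spectral measure of the (unbounded) operator `T`:
`(T f, g) = ∫ x dE_{f,g}(x)` for all `f` in the domain of `T` and all `g`. -/
def IsSpectralMeasureOf (E : SpectralMeasure 𝕜 H) (T : H →ₗ.[𝕜] H) : Prop :=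
  ∀ (f : T.domain) (g : H),
    (E.scalar f g).Integrable (fun x : PosReal => (x : ℝ)) ∧
      inner 𝕜 g (T f) = ∫ᵛ x, (x : ℝ) ∂•(E.scalar f g)

/-- `‖f‖²_w = ∫ w dE_{f,f}`, as an extended nonnegative number. -/
noncomputable def energy (E : SpectralMeasure 𝕜 H) (w : IndexFunction) (f : H) : ℝ≥0∞ :=
  ∫⁻ x, ENNReal.ofReal (w x) ∂(E.measure f)

theorem measure_smul (E : SpectralMeasure 𝕜 H) (c : 𝕜) (f : H) :
    E.measure (c • f) = ‖c‖ₑ ^ 2 • E.measure f := by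
  ext A hA
  rw [E.measure_apply _ hA, Measure.smul_apply, E.measure_apply _ hA, map_smul, enorm_smul,
    mul_pow, smul_eq_mul]

theorem energy_smul (E : SpectralMeasure 𝕜 H) (w : IndexFunction) (c : 𝕜) (f : H) :
    E.energy w (c • f) = ‖c‖ₑ ^ 2 * E.energy w f := by
  rw [energy, measure_smul, lintegral_smul_measure, smul_eq_mul, energy]

theorem enorm_parallelogram (𝕜 : Type*) {H : Type*} [RCLike 𝕜] [NormedAddCommGroup H]
    [InnerProductSpace 𝕜 H] (x y : H) :
    ‖x + y‖ₑ ^ 2 + ‖x - y‖ₑ ^ 2 = 2 * (‖x‖ₑ ^ 2 + ‖y‖ₑ ^ 2) := by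
  have h := parallelogram_law_with_norm 𝕜 x y
  rw [← ofReal_norm, ← ofReal_norm, ← ofReal_norm, ← ofReal_norm]
  simp only [← ENNReal.ofReal_pow (norm_nonneg _)]
  rw [← ENNReal.ofReal_add (by positivity) (by positivity),
    ← ENNReal.ofReal_add (by positivity) (by positivity), h,
    ENNReal.ofReal_mul (by norm_num)]
  simp

theorem energy_parallelogram (E : SpectralMeasure 𝕜 H) (w : IndexFunction) (f g : H) :
    E.energy w (f + g) + E.energy w (f - g) = 2 * (E.energy w f + E.energy w g) := by
  have h : E.measure (f + g) + E.measure (f - g) =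
      (2 : ℝ≥0∞) • (E.measure f + E.measure g) := by
    ext A hA
    simp only [Measure.add_apply, Measure.smul_apply, E.measure_apply _ hA, map_add, map_sub,
      smul_eq_mul]
    exact enorm_parallelogram 𝕜 _ _
  simp only [energy]
  rw [← lintegral_add_measure, h, lintegral_smul_measure, lintegral_add_measure, smul_eq_mul]

theorem energy_add_lt_top (E : SpectralMeasure 𝕜 H) (w : IndexFunction) {f g : H}
    (hf : E.energy w f < ⊤) (hg : E.energy w g < ⊤) : E.energy w (f + g) < ⊤ := by
  refine lt_of_le_of_lt (le_self_add.trans (E.energy_parallelogram w f g).le) ?_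
  exact ENNReal.mul_lt_top (by simp) (ENNReal.add_lt_top.2 ⟨hf, hg⟩)

theorem simpleFunc_triangle (E : SpectralMeasure 𝕜 H) (s : SimpleFunc PosReal ℝ≥0∞) (f g : H) :
    (s.lintegral (E.measure (f + g))) ^ (1 / 2 : ℝ) ≤
      (s.lintegral (E.measure f)) ^ (1 / 2 : ℝ) + (s.lintegral (E.measure g)) ^ (1 / 2 : ℝ) := by
  have key : ∀ h : H, s.lintegral (E.measure h) =
      ∑ c ∈ s.range, (c ^ (1 / 2 : ℝ) * ‖E.proj (s ⁻¹' {c}) h‖ₑ) ^ (2 : ℝ) := by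
    intro h
    refine Finset.sum_congr rfl fun c _ => ?_
    rw [E.measure_apply _ (s.measurableSet_fiber c), ENNReal.mul_rpow_of_nonneg _ _ (by norm_num),
      ← ENNReal.rpow_mul]
    norm_num
  rw [key, key, key]
  refine le_trans ?_ (ENNReal.Lp_add_le s.range _ _ (by norm_num))
  gcongr with c
  rw [← mul_add, map_add]
  gcongr
  exact enorm_add_le _ _

theorem energy_triangle (E : SpectralMeasure 𝕜 H) (w : IndexFunction) (f g : H) :
    (E.energy w (f + g)) ^ (1 / 2 : ℝ) ≤
      (E.energy w f) ^ (1 / 2 : ℝ) + (E.energy w g) ^ (1 / 2 : ℝ) := by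
  have key : E.energy w (f + g) ≤
      ((E.energy w f) ^ (1 / 2 : ℝ) + (E.energy w g) ^ (1 / 2 : ℝ)) ^ (2 : ℝ) := by
    rw [energy, lintegral]
    refine iSup₂_le fun s hs => ?_
    have hle : ∀ h : H, s.lintegral (E.measure h) ≤ E.energy w h := fun h => by
      rw [← SimpleFunc.lintegral_eq_lintegral]
      exact lintegral_mono hs
    have h1 := (E.simpleFunc_triangle s f g).trans (add_le_add
      (ENNReal.rpow_le_rpow (hle f) (by norm_num)) (ENNReal.rpow_le_rpow (hle g) (by norm_num)))
    have h2 := ENNReal.rpow_le_rpow h1 (z := 2) (by norm_num)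
    rw [← ENNReal.rpow_mul] at h2
    norm_num at h2 ⊢
    exact h2
  have h2 := ENNReal.rpow_le_rpow key (z := 1 / 2) (by norm_num)
  rw [← ENNReal.rpow_mul] at h2
  norm_num at h2 ⊢
  exact h2

theorem energy_eq_zero (E : SpectralMeasure 𝕜 H) (w : IndexFunction) {f : H}
    (h : E.energy w f = 0) : f = 0 := by
  have hm : Measurable fun x : PosReal => ENNReal.ofReal (w x) :=
    (measurable_subtype_coe.comp w.measurable_toFun).ennreal_ofReal
  rw [energy, lintegral_eq_zero_iff hm] at h
  have h0 : E.measure f Set.univ = 0 := by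
    have : {x : PosReal | ¬ ENNReal.ofReal (w x) = 0} = Set.univ := by
      ext x
      simpa using (w x).2
    rw [← this]
    exact h
  rw [E.measure_apply _ MeasurableSet.univ, E.proj_univ] at h0
  simpa using h0

/-- The linear subspace `{f ∈ H : ∫ w dE_{f,f} < ∞}` of `H`. -/
def domSubmodule (E : SpectralMeasure 𝕜 H) (w : IndexFunction) : Submodule 𝕜 H where
  carrier := {f | E.energy w f < ⊤}
  add_mem' hf hg := E.energy_add_lt_top w hf hg
  zero_mem' := by
    have := E.energy_smul w (0 : 𝕜) 0
    simp at this
    simp [this]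
  smul_mem' c f hf := by
    change E.energy w (c • f) < ⊤
    rw [energy_smul]
    exact ENNReal.mul_lt_top (by finiteness) hf

/-- The domain of the form `(·,·)_w`, as a space of its own; it carries the norm `‖·‖_w`, not the
norm of `H`. -/
def Dom (E : SpectralMeasure 𝕜 H) (w : IndexFunction) : Type _ := E.domSubmodule w

namespace Dom

variable {E : SpectralMeasure 𝕜 H} {v w : IndexFunction}

instance : AddCommGroup (E.Dom w) := inferInstanceAs (AddCommGroup (E.domSubmodule w))

instance : Module 𝕜 (E.Dom w) := inferInstanceAs (Module 𝕜 (E.domSubmodule w))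

/-- The underlying vector of `H`. -/
def val : E.Dom w →ₗ[𝕜] H := (E.domSubmodule w).subtype

theorem energy_lt_top (f : E.Dom w) : E.energy w (val f) < ⊤ := f.2

theorem val_injective : Function.Injective (val : E.Dom w →ₗ[𝕜] H) := Subtype.coe_injective

/-- `‖f‖_w = (∫ w dE_{f,f}) ^ (1/2)`. -/
noncomputable instance : Norm (E.Dom w) := ⟨fun f => √(E.energy w (val f)).toReal⟩

theorem norm_def (f : E.Dom w) : ‖f‖ = √(E.energy w (val f)).toReal := rfl

theorem norm_sq (f : E.Dom w) : ‖f‖ ^ 2 = (E.energy w (val f)).toReal :=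
  Real.sq_sqrt ENNReal.toReal_nonneg

theorem norm_eq_rpow (f : E.Dom w) :
    ‖f‖ = ((E.energy w (val f)) ^ (1 / 2 : ℝ)).toReal := by
  rw [norm_def, Real.sqrt_eq_rpow, ENNReal.toReal_rpow]

theorem norm_smul_eq (c : 𝕜) (f : E.Dom w) : ‖c • f‖ = ‖c‖ * ‖f‖ := by
  rw [norm_def, norm_def, map_smul, energy_smul, ENNReal.toReal_mul, ENNReal.toReal_pow,
    toReal_enorm, Real.sqrt_mul (by positivity), Real.sqrt_sq (norm_nonneg _)]

noncomputable instance : NormedAddCommGroup (E.Dom w) :=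
  AddGroupNorm.toNormedAddCommGroup
    { toFun := fun f => ‖f‖
      map_zero' := by
        have h := norm_smul_eq (0 : 𝕜) (0 : E.Dom w)
        rw [zero_smul, norm_zero, zero_mul] at h
        exact h
      add_le' := fun f g => by
        have hf : (E.energy w (val f)) ^ (1 / 2 : ℝ) ≠ ⊤ :=
          ENNReal.rpow_ne_top_of_nonneg (by norm_num) (energy_lt_top f).ne
        have hg : (E.energy w (val g)) ^ (1 / 2 : ℝ) ≠ ⊤ :=
          ENNReal.rpow_ne_top_of_nonneg (by norm_num) (energy_lt_top g).ne
        simp only [norm_eq_rpow]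
        rw [← ENNReal.toReal_add hf hg, map_add]
        exact ENNReal.toReal_mono (ENNReal.add_ne_top.2 ⟨hf, hg⟩) (E.energy_triangle w _ _)
      neg' := fun f => by
        have h := norm_smul_eq (-1 : 𝕜) f
        rw [neg_one_smul, norm_neg, norm_one, one_mul] at h
        exact h
      eq_zero_of_map_eq_zero' := fun f hf => by
        have h : (E.energy w (val f)).toReal = 0 := by
          rw [← norm_sq]
          change ‖f‖ = 0 at hf
          rw [hf]
          norm_num
        have h0 : E.energy w (val f) = 0 :=
          ((ENNReal.toReal_eq_zero_iff _).1 h).resolve_right (energy_lt_top f).ne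
        exact val_injective ((E.energy_eq_zero w h0).trans (map_zero val).symm) }

noncomputable instance : NormedSpace 𝕜 (E.Dom w) where
  norm_smul_le c f := (norm_smul_eq c f).le

/-- The scalar product `(·,·)_w`, which the norm determines by polarization. -/
noncomputable instance : InnerProductSpace 𝕜 (E.Dom w) :=
  InnerProductSpace.ofNorm 𝕜 fun f g => by
    have h := congrArg ENNReal.toReal (E.energy_parallelogram w (val f) (val g))
    rw [← map_add, ← map_sub, ENNReal.toReal_add (energy_lt_top _).ne (energy_lt_top _).ne,
      ENNReal.toReal_mul, ENNReal.toReal_add (energy_lt_top _).ne (energy_lt_top _).ne] at h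
    simp only [← pow_two, norm_sq]
    simpa using h

theorem energy_mono (E : SpectralMeasure 𝕜 H) (h : v ≤ w) (f : H) :
    E.energy v f ≤ E.energy w f :=
  lintegral_mono fun x => ENNReal.ofReal_le_ofReal (h x)

/-- For `v ≤ w`, the inclusion of the domain of `(·,·)_w` in the domain of `(·,·)_v`. -/
noncomputable def inclusion (h : v ≤ w) : E.Dom w →L[𝕜] E.Dom v :=
  LinearMap.mkContinuous
    (Submodule.inclusion (fun f hf => (energy_mono E h f).trans_lt hf :
      E.domSubmodule w ≤ E.domSubmodule v) : E.Dom w →ₗ[𝕜] E.Dom v) 1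
    (fun f => by
      rw [one_mul]
      exact Real.sqrt_le_sqrt
        (ENNReal.toReal_mono (energy_lt_top f).ne (energy_mono E h (val f))))

theorem val_inclusion (h : v ≤ w) (f : E.Dom w) : val (inclusion h f) = val f := rfl

end Dom

/-- The member `H_w` of the variable Hilbert scale: the completion of the domain of the form
`(·,·)_w` for the norm `‖·‖_w`. -/
abbrev Scale (E : SpectralMeasure 𝕜 H) (w : IndexFunction) : Type _ :=
  UniformSpace.Completion (E.Dom w)

/-- For `v ≤ w`, the embedding `H_w ↪ H_v`, the continuous extension of the inclusion of the
domains. -/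
noncomputable def embed (E : SpectralMeasure 𝕜 H) {v w : IndexFunction} (h : v ≤ w) :
    E.Scale w →L[𝕜] E.Scale v :=
  (Dom.inclusion h).completion

/-- For `v ≤ w`, the norm `‖f‖_v` of an `f ∈ H_w`, regarded as an element of `H_v`. -/
noncomputable def normIn (E : SpectralMeasure 𝕜 H) (v : IndexFunction) {w : IndexFunction}
    (h : v ≤ w) (f : E.Scale w) : ℝ :=
  ‖E.embed h f‖

/-- On the domain of `(·,·)_w`, which is dense in `H_w`, the norm is the spectral integral. -/
theorem normIn_coe_sq (E : SpectralMeasure 𝕜 H) {v w : IndexFunction} (h : v ≤ w)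
    (f : E.Dom w) :
    E.normIn v h (f : E.Scale w) ^ 2 =
      (∫⁻ x, ENNReal.ofReal (v x) ∂(E.measure (Dom.val f))).toReal := by
  have h1 : E.embed h (f : E.Scale w) = ((Dom.inclusion h f : E.Dom v) : E.Scale v) := by
    exact (Dom.inclusion h).completion_apply_coe f
  rw [normIn, h1, UniformSpace.Completion.norm_coe, Dom.norm_sq, Dom.val_inclusion, energy]

end SpectralMeasure

/-! The theorem is Jensen's inequality for a probability measure `ρ` attached to `f`. For `f` in the
domain of the form, take `dρ = θ dE_{f,f} / ‖f‖_θ²`; then `‖f‖_{φθ}² / ‖f‖_θ² = ∫ φ dρ`, and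
likewise for `ψ`. Part (i) is Jensen for the concave function `φ ∘ ψ⁻¹` and the random variable `ψ`.
Part (ii) is Jensen for the convex function `ψ ∘ φ⁻¹` and the random variable `φ`, followed by
cancelling the increasing function `ψ`.

Two points need work. An element of the completion `H_w` need not come from a vector of `H`, so it
has no measure `E_{f,f}` at hand. Its substitute comes from extending the projections `E(A)` to
`H_w`: the set function `A ↦ ‖E(A)f‖_w²` is a uniform limit of the measures `w dE_{g,g}` with `g` in
the domain, hence a measure `ν`, and `dμ = dν / w` gives `‖f‖_v² = ∫ v dμ` for all `v ≤ w`
(`exists_measure_forall_normIn_sq`). Also, the interval in Jensen's inequality may contain an end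
point at which the function jumps; the mean is such an end point only when the variable is almost
surely constant, and then the inequality is trivial. -/

/-! ### Uniform approximation of measures -/

open scoped NNReal in
/-- A set function that is uniformly approximated by measures is a measure. -/
theorem exists_measure_of_uniform_approx {α : Type*} [MeasurableSpace α] (m : Set α → ℝ≥0∞)
    (h : ∀ ε : ℝ≥0, 0 < ε → ∃ μ : Measure α, ∀ A, MeasurableSet A →
      μ A ≤ m A + ε ∧ m A ≤ μ A + ε) :
    ∃ ν : Measure α, ∀ A, MeasurableSet A → ν A = m A := by
  have hempty : m ∅ = 0 := by
    refine le_antisymm (ENNReal.le_of_forall_pos_le_add fun ε hε _ => ?_) zero_le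
    obtain ⟨μ, hμ⟩ := h ε hε
    simpa using (hμ ∅ MeasurableSet.empty).2
  have hfin : ∀ A : ℕ → Set α, (∀ n, MeasurableSet (A n)) →
      Pairwise (Function.onFun Disjoint A) → ∀ s : Finset ℕ, ∀ B, MeasurableSet B →
      (⋃ i ∈ s, A i) ⊆ B → (∑ i ∈ s, m (A i) ≤ m B ∧ m (⋃ i ∈ s, A i) ≤ ∑ i ∈ s, m (A i)) := by
    intro A hA hd s B hB hsB
    have hU : MeasurableSet (⋃ i ∈ s, A i) := s.measurableSet_biUnion fun i _ => hA i
    have hsum : ∀ μ : Measure α, μ (⋃ i ∈ s, A i) = ∑ i ∈ s, μ (A i) := fun μ =>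
      measure_biUnion_finset (hd.set_pairwise _) fun i _ => hA i
    -- The approximation error is paid once for each `A i` and once more for the containing set or
    -- the union.
    have key : ∀ ε : ℝ≥0, 0 < ε → ∃ δ : ℝ≥0, 0 < δ ∧ (s.card : ℝ≥0∞) * δ + δ = ε := by
      intro ε hε
      refine ⟨ε / (s.card + 1), by positivity, ?_⟩
      norm_cast
      field_simp
      push_cast
      rfl
    constructor
    · refine ENNReal.le_of_forall_pos_le_add fun ε hε _ => ?_
      obtain ⟨δ, hδ, hδε⟩ := key ε hε
      obtain ⟨μ, hμ⟩ := h δ hδ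
      calc ∑ i ∈ s, m (A i) ≤ ∑ i ∈ s, (μ (A i) + δ) :=
            Finset.sum_le_sum fun i _ => (hμ _ (hA i)).2
        _ = μ (⋃ i ∈ s, A i) + s.card * δ := by
            rw [Finset.sum_add_distrib, hsum, Finset.sum_const, nsmul_eq_mul]
        _ ≤ (m B + δ) + s.card * δ := by
            gcongr
            exact (measure_mono hsB).trans (hμ B hB).1
        _ = m B + ε := by rw [← hδε]; ring
    · refine ENNReal.le_of_forall_pos_le_add fun ε hε _ => ?_
      obtain ⟨δ, hδ, hδε⟩ := key ε hε
      obtain ⟨μ, hμ⟩ := h δ hδ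
      calc m (⋃ i ∈ s, A i) ≤ μ (⋃ i ∈ s, A i) + δ := (hμ _ hU).2
        _ ≤ ∑ i ∈ s, (m (A i) + δ) + δ := by
            rw [hsum]
            gcongr with i
            exact (hμ _ (hA i)).1
        _ = ∑ i ∈ s, m (A i) + ε := by
            rw [Finset.sum_add_distrib, Finset.sum_const, nsmul_eq_mul, ← hδε]; ring
  refine ⟨Measure.ofMeasurable (fun A _ => m A) hempty ?_, fun A hA =>
    Measure.ofMeasurable_apply A hA⟩
  intro A hA hd
  have hU : MeasurableSet (⋃ i, A i) := MeasurableSet.iUnion hA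
  refine le_antisymm (ENNReal.le_of_forall_pos_le_add fun ε hε _ => ?_)
    (ENNReal.tsum_eq_iSup_sum.trans_le
      (iSup_le fun s => (hfin A hA hd s _ hU (by simp [Set.subset_iUnion])).1))
  -- A single `μ` is compared with `m` on finite unions, not term by term, so the error does not
  -- grow with the number of sets.
  obtain ⟨μ, hμ⟩ := h (ε / 2) (half_pos hε)
  have h1 : μ (⋃ i, A i) ≤ ∑' i, m (A i) + (ε / 2 : ℝ≥0) := by
    rw [measure_iUnion hd hA, ENNReal.tsum_eq_iSup_sum]
    refine iSup_le fun s => ?_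
    have hUs : MeasurableSet (⋃ i ∈ s, A i) := s.measurableSet_biUnion fun i _ => hA i
    rw [← measure_biUnion_finset (hd.set_pairwise _) fun i _ => hA i]
    refine (hμ _ hUs).1.trans ?_
    gcongr
    exact (hfin A hA hd s _ hUs subset_rfl).2.trans (ENNReal.sum_le_tsum s)
  refine (hμ _ hU).2.trans ((add_le_add_left h1 _).trans_eq ?_)
  rw [add_assoc, ← ENNReal.coe_add, add_halves]

/-- Measures that are close uniformly on measurable sets have close integrals of functions with
values in `[0, 1]`. -/
theorem lintegral_le_lintegral_add_of_forall_measure_le {α : Type*} [MeasurableSpace α]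
    {μ ν : Measure α} {ε : ℝ≥0∞} (h : ∀ A, MeasurableSet A → μ A ≤ ν A + ε) {f : α → ℝ}
    (hf : Measurable f) (hf0 : ∀ x, 0 ≤ f x) (hf1 : ∀ x, f x ≤ 1) :
    ∫⁻ x, ENNReal.ofReal (f x) ∂μ ≤ ∫⁻ x, ENNReal.ofReal (f x) ∂ν + ε := by
  rw [lintegral_eq_lintegral_meas_lt μ (.of_forall hf0) hf.aemeasurable,
    lintegral_eq_lintegral_meas_lt ν (.of_forall hf0) hf.aemeasurable]
  -- Layer-cake formula: the superlevel sets are empty for `t ≥ 1`, so the error `ε` is integrated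
  -- over `(0, 1)` only.
  calc ∫⁻ t in Set.Ioi (0 : ℝ), μ {a | t < f a}
      ≤ ∫⁻ t in Set.Ioi (0 : ℝ), (ν {a | t < f a} + (Set.Iio 1).indicator (fun _ => ε) t) := by
        refine lintegral_mono fun t => ?_
        by_cases ht : t < 1
        · rw [Set.indicator_of_mem (by exact ht)]
          exact h _ (measurableSet_lt measurable_const hf)
        · have : {a | t < f a} = ∅ := by
            ext a
            simpa using (hf1 a).trans (not_lt.1 ht)
          simp [this]
    _ = (∫⁻ t in Set.Ioi (0 : ℝ), ν {a | t < f a}) + ε := by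
        rw [lintegral_add_right _ (measurable_const.indicator measurableSet_Iio),
          lintegral_indicator_const measurableSet_Iio,
          Measure.restrict_apply measurableSet_Iio, Set.inter_comm, Set.Ioi_inter_Iio]
        simp

/-! ### Jensen's inequality on an arbitrary interval -/

/-- A convex function on an interval has a supporting line at each interior point. -/
theorem ConvexOn.exists_supporting_line {s : Set ℝ} {g : ℝ → ℝ} (hg : ConvexOn ℝ s g) {t : ℝ}
    (ht : t ∈ interior s) : ∃ k : ℝ, ∀ y ∈ s, g t + k * (y - t) ≤ g y := by
  -- The right derivative serves on both sides: slopes from the left are at most the left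
  -- derivative, which is at most the right one.
  refine ⟨derivWithin g (Set.Ioi t) t, fun y hy => ?_⟩
  rcases lt_trichotomy y t with hyt | rfl | hyt
  · have h1 := (hg.slope_le_leftDeriv_of_mem_interior hy ht hyt).trans
      (hg.leftDeriv_le_rightDeriv_of_mem_interior ht)
    rw [slope_def_field, div_le_iff₀ (sub_pos.2 hyt)] at h1
    linarith
  · simp
  · have h1 := hg.rightDeriv_le_slope_of_mem_interior ht hy hyt
    rw [slope_def_field, le_div_iff₀ (sub_pos.2 hyt)] at h1
    linarith

/-- Either a random variable is almost surely its mean, or it takes values on both sides. -/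
theorem ae_eq_integral_or_exists_lt_lt {Ω : Type*} [MeasurableSpace Ω] {ρ : Measure Ω}
    [IsProbabilityMeasure ρ] {X : Ω → ℝ} (hX : Integrable X ρ) :
    (∀ᵐ ω ∂ρ, X ω = ∫ x, X x ∂ρ) ∨ ∃ ω₁ ω₂, X ω₁ < ∫ x, X x ∂ρ ∧ ∫ x, X x ∂ρ < X ω₂ := by
  have hc : Integrable (fun _ : Ω => ∫ x, X x ∂ρ) ρ := integrable_const _
  by_cases h1 : ∃ ω, X ω < ∫ x, X x ∂ρ
  · by_cases h2 : ∃ ω, ∫ x, X x ∂ρ < X ω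
    · exact .inr ⟨h1.choose, h2.choose, h1.choose_spec, h2.choose_spec⟩
    · push Not at h2
      exact .inl ((integral_eq_iff_of_ae_le hX hc (.of_forall h2)).1 (by simp))
  · push Not at h1
    left
    filter_upwards [(integral_eq_iff_of_ae_le hc hX (.of_forall h1)).1 (by simp)] with ω hω
    exact hω.symm

/-- The mean of a random variable lies in every convex set containing its values. -/
theorem integral_mem_of_convex {Ω : Type*} [MeasurableSpace Ω] {ρ : Measure Ω}
    [IsProbabilityMeasure ρ] {X : Ω → ℝ} (hX : Integrable X ρ) {s : Set ℝ} (hs : Convex ℝ s)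
    (hXs : ∀ ω, X ω ∈ s) : ∫ x, X x ∂ρ ∈ s := by
  rcases ae_eq_integral_or_exists_lt_lt hX with h | ⟨ω₁, ω₂, h1, h2⟩
  · obtain ⟨ω, hω⟩ := h.exists
    exact hω ▸ hXs ω
  · exact hs.ordConnected.out (hXs ω₁) (hXs ω₂) ⟨h1.le, h2.le⟩

/-- Jensen's inequality on the line, for an interval that need not be closed and a convex function
that need not be continuous at its end points. -/
theorem ConvexOn.map_integral_le_integral_real {Ω : Type*} [MeasurableSpace Ω] {ρ : Measure Ω}
    [IsProbabilityMeasure ρ] {X : Ω → ℝ} (hX : Integrable X ρ) {s : Set ℝ} {g : ℝ → ℝ}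
    (hg : ConvexOn ℝ s g) (hXs : ∀ ω, X ω ∈ s) (hgX : Integrable (fun ω => g (X ω)) ρ) :
    g (∫ x, X x ∂ρ) ≤ ∫ x, g (X x) ∂ρ := by
  rcases ae_eq_integral_or_exists_lt_lt hX with h | ⟨ω₁, ω₂, h1, h2⟩
  -- The mean may be an end point of `s` here, but both sides equal `g` at the mean.
  · rw [integral_congr_ae (h.mono fun ω hω => congrArg g hω)]
    simp
  · have hint : ∫ x, X x ∂ρ ∈ interior s :=
      mem_interior_iff_mem_nhds.2 (Filter.mem_of_superset (Icc_mem_nhds h1 h2)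
        (hg.1.ordConnected.out (hXs ω₁) (hXs ω₂)))
    obtain ⟨k, hk⟩ := hg.exists_supporting_line hint
    have hi : Integrable (fun ω => k * (X ω - ∫ x, X x ∂ρ)) ρ :=
      (hX.sub (integrable_const _)).const_mul k
    have h3 := integral_mono ((integrable_const (g (∫ x, X x ∂ρ))).add hi) hgX
      fun ω => hk _ (hXs ω)
    simp only [Pi.add_apply] at h3
    rw [integral_add (integrable_const _) hi, integral_const_mul,
      integral_sub hX (integrable_const _)] at h3
    simpa using h3

/-! ### Representing measures for elements of the completion -/

namespace SpectralMeasure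

variable {𝕜 H : Type*} [RCLike 𝕜] [NormedAddCommGroup H] [InnerProductSpace 𝕜 H]
  [CompleteSpace H]

theorem measure_proj (E : SpectralMeasure 𝕜 H) (f : H) {A : Set PosReal} (hA : MeasurableSet A) :
    E.measure (E.proj A f) = (E.measure f).restrict A := by
  ext B hB
  rw [Measure.restrict_apply hB, E.measure_apply _ hB, E.measure_apply _ (hB.inter hA),
    E.proj_inter B A hB hA]
  rfl

theorem measurable_weight (w : IndexFunction) :
    Measurable fun x : PosReal => ENNReal.ofReal (w x) :=
  (measurable_subtype_coe.comp w.measurable_toFun).ennreal_ofReal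

/-- For a vector `g` of the domain this makes `A ↦ ‖E(A)g‖_w²` a measure, the property to be carried
over to the completion. -/
theorem energy_proj (E : SpectralMeasure 𝕜 H) (w : IndexFunction) (f : H) {A : Set PosReal}
    (hA : MeasurableSet A) :
    E.energy w (E.proj A f) = (E.measure f).withDensity (fun x => ENNReal.ofReal (w x)) A := by
  rw [energy, measure_proj E f hA, withDensity_apply _ hA]

theorem energy_proj_le (E : SpectralMeasure 𝕜 H) (w : IndexFunction) (f : H) {A : Set PosReal}
    (hA : MeasurableSet A) : E.energy w (E.proj A f) ≤ E.energy w f := by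
  rw [energy, measure_proj E f hA, energy]
  exact setLIntegral_le_lintegral A _

namespace Dom

variable {E : SpectralMeasure 𝕜 H} {v w : IndexFunction}

theorem ofReal_norm_sq (f : E.Dom w) : ENNReal.ofReal (‖f‖ ^ 2) = E.energy w (val f) := by
  rw [norm_sq, ENNReal.ofReal_toReal (energy_lt_top f).ne]

/-- The restriction of the spectral projection `E(A)` to the domain of `(·,·)_w`. -/
noncomputable def cutoff (E : SpectralMeasure 𝕜 H) (w : IndexFunction) {A : Set PosReal}
    (hA : MeasurableSet A) : E.Dom w →L[𝕜] E.Dom w :=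
  LinearMap.mkContinuous
    ((E.proj A : H →ₗ[𝕜] H).restrict (p := E.domSubmodule w) (q := E.domSubmodule w)
      (fun f hf => (E.energy_proj_le w f hA).trans_lt hf) : E.Dom w →ₗ[𝕜] E.Dom w) 1
    (fun f => by
      rw [one_mul]
      exact Real.sqrt_le_sqrt
        (ENNReal.toReal_mono (energy_lt_top f).ne (E.energy_proj_le w (val f) hA)))

theorem val_cutoff {A : Set PosReal} (hA : MeasurableSet A) (f : E.Dom w) :
    val (cutoff E w hA f) = E.proj A (val f) := rfl

theorem norm_cutoff_le {A : Set PosReal} (hA : MeasurableSet A) :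
    ‖cutoff E w hA‖ ≤ 1 :=
  LinearMap.mkContinuous_norm_le _ zero_le_one _

theorem norm_inclusion_le (h : v ≤ w) : ‖(inclusion h : E.Dom w →L[𝕜] E.Dom v)‖ ≤ 1 :=
  LinearMap.mkContinuous_norm_le _ zero_le_one _

end Dom

theorem norm_completion_apply_le {V W : Type*} [NormedAddCommGroup V] [NormedSpace 𝕜 V]
    [NormedAddCommGroup W] [NormedSpace 𝕜 W] {F : V →L[𝕜] W} (hF : ‖F‖ ≤ 1)
    (f : UniformSpace.Completion V) : ‖F.completion f‖ ≤ ‖f‖ := by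
  induction f using UniformSpace.Completion.induction_on with
  | hp => exact isClosed_le F.completion.continuous.norm continuous_norm
  | ih a =>
    rw [ContinuousLinearMap.completion_apply_coe, UniformSpace.Completion.norm_coe,
      UniformSpace.Completion.norm_coe]
    exact F.le_of_opNorm_le_of_le hF le_rfl |>.trans_eq (one_mul _)

/-- The bound `‖f - g‖ (‖f‖ + ‖g‖)` does not involve `F`. Hence one `g` serves all contractions at
once: every cutoff `E(A)` and every inclusion into an `H_v`. -/
theorem exists_coe_forall_abs_sq_sub_sq_le {V : Type*} [NormedAddCommGroup V] [NormedSpace 𝕜 V]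
    (f : UniformSpace.Completion V) {ε : ℝ} (hε : 0 < ε) :
    ∃ g : V, ∀ {W : Type*} [NormedAddCommGroup W] [NormedSpace 𝕜 W] (F : V →L[𝕜] W), ‖F‖ ≤ 1 →
      |‖F.completion f‖ ^ 2 - ‖F g‖ ^ 2| ≤ ε := by
  have hc : Continuous fun g : UniformSpace.Completion V => ‖f - g‖ * (‖f‖ + ‖g‖) := by fun_prop
  obtain ⟨g, hg⟩ := UniformSpace.Completion.denseRange_coe.exists_mem_open
    (isOpen_Iio.preimage hc) ⟨f, show ‖f - f‖ * (‖f‖ + ‖f‖) < ε by simpa using hε⟩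
  refine ⟨g, fun F hF => ?_⟩
  have hgF : ‖F g‖ = ‖F.completion (g : UniformSpace.Completion V)‖ := by
    rw [ContinuousLinearMap.completion_apply_coe, UniformSpace.Completion.norm_coe]
  have h1 : |‖F.completion f‖ - ‖F g‖| ≤ ‖f - g‖ := by
    rw [hgF]
    refine (abs_norm_sub_norm_le _ _).trans ?_
    rw [← map_sub]
    exact norm_completion_apply_le hF _
  have h2 : ‖F.completion f‖ + ‖F g‖ ≤ ‖f‖ + ‖(g : UniformSpace.Completion V)‖ := by
    rw [hgF]
    exact add_le_add (norm_completion_apply_le hF _) (norm_completion_apply_le hF _)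
  rw [sq_sub_sq, abs_mul, abs_of_nonneg (by positivity : 0 ≤ ‖F.completion f‖ + ‖F g‖), mul_comm]
  exact (mul_le_mul h1 h2 (by positivity) (norm_nonneg _)).trans (le_of_lt hg)

theorem ofReal_le_of_abs_sub_le {a b ε : ℝ} (hε : 0 ≤ ε) (hb : 0 ≤ b) (h : |a - b| ≤ ε) :
    ENNReal.ofReal a ≤ ENNReal.ofReal b + ENNReal.ofReal ε := by
  rw [← ENNReal.ofReal_add hb hε]
  exact ENNReal.ofReal_le_ofReal (by linarith [le_abs_self (a - b)])

open Classical in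
/-- Every element of `H_w` has a measure representing its norms in the spaces `H_v`, `v ≤ w`. -/
theorem exists_measure_forall_normIn_sq (E : SpectralMeasure 𝕜 H) {w : IndexFunction}
    (f : E.Scale w) : ∃ μ : Measure PosReal, ∀ (v : IndexFunction) (h : v ≤ w),
      ∫⁻ x, ENNReal.ofReal (v x) ∂μ = ENNReal.ofReal (E.normIn v h f ^ 2) := by
  set m : Set PosReal → ℝ≥0∞ := fun A =>
    if hA : MeasurableSet A then ENNReal.ofReal (‖(Dom.cutoff E w hA).completion f‖ ^ 2) else 0
    with hm
  set μ₀ : E.Dom w → Measure PosReal := fun g =>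
    (E.measure (Dom.val g)).withDensity fun x => ENNReal.ofReal (w x) with hμ₀
  have happ : ∀ ε : ℝ, 0 < ε → ∃ g : E.Dom w,
      (∀ A, MeasurableSet A → μ₀ g A ≤ m A + ENNReal.ofReal ε ∧
        m A ≤ μ₀ g A + ENNReal.ofReal ε) ∧
      ∀ (v : IndexFunction) (h : v ≤ w),
        E.energy v (Dom.val g) ≤ ENNReal.ofReal (E.normIn v h f ^ 2) + ENNReal.ofReal ε ∧
        ENNReal.ofReal (E.normIn v h f ^ 2) ≤ E.energy v (Dom.val g) + ENNReal.ofReal ε := by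
    intro ε hε
    obtain ⟨g, hg⟩ := exists_coe_forall_abs_sq_sub_sq_le (𝕜 := 𝕜) f hε
    refine ⟨g, fun A hA => ?_, fun v h => ?_⟩
    · have h1 := hg (Dom.cutoff E w hA) (Dom.norm_cutoff_le hA)
      have h2 : μ₀ g A = ENNReal.ofReal (‖Dom.cutoff E w hA g‖ ^ 2) := by
        rw [Dom.ofReal_norm_sq, Dom.val_cutoff, energy_proj E w _ hA]
      simp only [hm, dif_pos hA, h2]
      exact ⟨ofReal_le_of_abs_sub_le hε.le (by positivity) (by rwa [abs_sub_comm]),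
        ofReal_le_of_abs_sub_le hε.le (by positivity) h1⟩
    · have h1 := hg (Dom.inclusion h) (Dom.norm_inclusion_le h)
      have h2 : E.energy v (Dom.val g) = ENNReal.ofReal (‖Dom.inclusion h g‖ ^ 2) := by
        rw [Dom.ofReal_norm_sq, Dom.val_inclusion]
      rw [h2]
      exact ⟨ofReal_le_of_abs_sub_le hε.le (by positivity) (by rwa [abs_sub_comm]),
        ofReal_le_of_abs_sub_le hε.le (by positivity) h1⟩
  obtain ⟨ν, hν⟩ := exists_measure_of_uniform_approx m fun ε hε => by
    obtain ⟨g, hg, -⟩ := happ ε hε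
    exact ⟨μ₀ g, by simpa using hg⟩
  -- Since `ν` plays the role of `w dE_{f,f}`, dividing by `w` recovers `E_{f,f}`. The integrand
  -- against `ν` becomes `v / w ≤ 1`, so uniform closeness of measures passes to the integrals.
  refine ⟨ν.withDensity fun x => (ENNReal.ofReal (w x))⁻¹, fun v h => ?_⟩
  have hquot : ∀ x, (ENNReal.ofReal (w x))⁻¹ * ENNReal.ofReal (v x) =
      ENNReal.ofReal (v x / w x : ℝ) := fun x => by
    rw [ENNReal.ofReal_div_of_pos (w x).2, div_eq_mul_inv, mul_comm]
  have hmq : Measurable fun x : PosReal => (v x / w x : ℝ) :=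
    (measurable_subtype_coe.comp v.measurable_toFun).div
      (measurable_subtype_coe.comp w.measurable_toFun)
  have hmi : Measurable fun x : PosReal => (ENNReal.ofReal (w x))⁻¹ := (measurable_weight w).inv
  have hq0 : ∀ x, (0 : ℝ) ≤ v x / w x := fun x => (div_pos (v x).2 (w x).2).le
  have hq1 : ∀ x, (v x / w x : ℝ) ≤ 1 := fun x => (div_le_one (w x).2).2 (h x)
  have hν' : ∫⁻ x, ENNReal.ofReal (v x) ∂(ν.withDensity fun x => (ENNReal.ofReal (w x))⁻¹) =
      ∫⁻ x, ENNReal.ofReal (v x / w x) ∂ν := by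
    rw [lintegral_withDensity_eq_lintegral_mul _ hmi (measurable_weight v)]
    exact lintegral_congr hquot
  have hg' : ∀ g : E.Dom w, E.energy v (Dom.val g) = ∫⁻ x, ENNReal.ofReal (v x / w x) ∂(μ₀ g) := by
    intro g
    rw [hμ₀, lintegral_withDensity_eq_lintegral_mul _ (measurable_weight w) hmq.ennreal_ofReal,
      energy]
    refine lintegral_congr fun x => ?_
    rw [Pi.mul_apply, ← ENNReal.ofReal_mul (w x).2.le, mul_div_cancel₀ _ (w x).2.ne']
  rw [hν']
  have key : ∀ ε : NNReal, 0 < ε → ∃ g : E.Dom w,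
      (∫⁻ x, ENNReal.ofReal (v x / w x) ∂ν ≤ ENNReal.ofReal (E.normIn v h f ^ 2) + ε) ∧
      ENNReal.ofReal (E.normIn v h f ^ 2) ≤ ∫⁻ x, ENNReal.ofReal (v x / w x) ∂ν + ε := by
    intro ε hε
    obtain ⟨g, hg1, hg2⟩ := happ (ε / 2 : NNReal) (half_pos hε)
    rw [ENNReal.ofReal_coe_nnreal] at hg1 hg2
    have h1 := lintegral_le_lintegral_add_of_forall_measure_le
      (fun A hA => (hν A hA).trans_le (hg1 A hA).2) hmq hq0 hq1
    have h2 := lintegral_le_lintegral_add_of_forall_measure_le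
      (fun A hA => (hg1 A hA).1.trans_eq (by rw [hν A hA])) hmq hq0 hq1
    rw [← hg'] at h1 h2
    have hε2 : (ε : ℝ≥0∞) = (ε / 2 : NNReal) + (ε / 2 : NNReal) := by
      rw [← ENNReal.coe_add, add_halves]
    rw [hε2, ← add_assoc, ← add_assoc]
    exact ⟨g, h1.trans (add_le_add_left (hg2 v h).1 _), (hg2 v h).2.trans (add_le_add_left h2 _)⟩
  exact le_antisymm
    (ENNReal.le_of_forall_pos_le_add fun ε hε _ => (key ε hε).choose_spec.1)
    (ENNReal.le_of_forall_pos_le_add fun ε hε _ => (key ε hε).choose_spec.2)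

theorem embed_refl (E : SpectralMeasure 𝕜 H) {w : IndexFunction} (h : w ≤ w) (f : E.Scale w) :
    E.embed h f = f := by
  induction f using UniformSpace.Completion.induction_on with
  | hp => exact isClosed_eq (E.embed h).continuous continuous_id
  | ih a => exact (Dom.inclusion h).completion_apply_coe a

/-- The norms of a nonzero element of `H_{(φ+ψ+1)θ}` are expectations for a probability measure. -/
theorem exists_probabilityMeasure (E : SpectralMeasure 𝕜 H) {θ w : IndexFunction} (hθ : θ ≤ w)
    {f : E.Scale w} (hf : f ≠ 0) :
    0 < E.normIn θ hθ f ^ 2 ∧ ∃ ρ : Measure PosReal, IsProbabilityMeasure ρ ∧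
      ∀ (φ : IndexFunction) (h : φ * θ ≤ w), Integrable (fun x => (φ x : ℝ)) ρ ∧
        E.normIn (φ * θ) h f ^ 2 / E.normIn θ hθ f ^ 2 = ∫ x, (φ x : ℝ) ∂ρ := by
  obtain ⟨μ, hμ⟩ := E.exists_measure_forall_normIn_sq f
  -- If `‖f‖_θ = 0`, positivity of `θ` forces `μ = 0`; the case `v = w` of the representation then
  -- gives `‖f‖_w = 0`, contradicting `f ≠ 0`.
  have hpos : 0 < E.normIn θ hθ f ^ 2 := by
    by_contra hn
    have h0 := hμ θ hθ
    rw [ENNReal.ofReal_of_nonpos (not_lt.1 hn), lintegral_eq_zero_iff (measurable_weight θ)] at h0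
    have hw := hμ w fun _ => le_rfl
    have hμ0 : μ = 0 := by
      refine Measure.measure_univ_eq_zero.1 ?_
      have : {x : PosReal | ¬ ENNReal.ofReal (θ x) = 0} = Set.univ := by
        ext x
        simpa using (θ x).2
      rw [← this]
      exact h0
    rw [hμ0, lintegral_zero_measure, normIn, embed_refl] at hw
    have : 0 < ‖f‖ ^ 2 := by positivity
    exact absurd hw.symm (ENNReal.ofReal_pos.2 this).ne'
  set c := E.normIn θ hθ f ^ 2 with hc
  have hc0 : ENNReal.ofReal c ≠ 0 := (ENNReal.ofReal_pos.2 hpos).ne'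
  set ρ : Measure PosReal :=
    (ENNReal.ofReal c)⁻¹ • μ.withDensity fun x => ENNReal.ofReal (θ x) with hρ
  refine ⟨hpos, ρ, ⟨?_⟩, fun φ h => ?_⟩
  · rw [hρ, Measure.smul_apply, withDensity_apply _ MeasurableSet.univ, Measure.restrict_univ,
      hμ θ hθ, smul_eq_mul, ENNReal.inv_mul_cancel hc0 ENNReal.ofReal_ne_top]
  · have hm : Measurable fun x : PosReal => (φ x : ℝ) :=
      measurable_subtype_coe.comp φ.measurable_toFun
    have hl : ∫⁻ x, ENNReal.ofReal (φ x) ∂ρ = ENNReal.ofReal (E.normIn (φ * θ) h f ^ 2 / c) := by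
      rw [hρ, lintegral_smul_measure, smul_eq_mul, lintegral_withDensity_eq_lintegral_mul _
        (measurable_weight θ) (measurable_weight φ), ENNReal.ofReal_div_of_pos hpos, ← hμ _ h,
        div_eq_mul_inv, mul_comm]
      congr 1
      refine lintegral_congr fun x => ?_
      rw [Pi.mul_apply, mul_comm, ← ENNReal.ofReal_mul (φ x).2.le]
      rfl
    have h0 : 0 ≤ᵐ[ρ] fun x : PosReal => (φ x : ℝ) := .of_forall fun x => (φ x).2.le
    refine ⟨⟨hm.aestronglyMeasurable, ?_⟩, ?_⟩
    · rw [hasFiniteIntegral_iff_ofReal h0, hl]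
      exact ENNReal.ofReal_lt_top
    · rw [integral_eq_lintegral_of_nonneg_ae h0 hm.aestronglyMeasurable, hl,
        ENNReal.toReal_ofReal (by positivity)]

end SpectralMeasure

/-! ### Ranges of index functions -/

namespace IndexFunction

theorem mem_range (φ : IndexFunction) (x : PosReal) : (φ x : ℝ) ∈ φ.range := ⟨x, rfl⟩

/-- An interval that is the range of a strictly increasing index function is open. -/
theorem isOpen_range {φ : IndexFunction} (hφ : StrictMono φ) (hc : Convex ℝ φ.range) :
    IsOpen φ.range := by
  rw [isOpen_iff_mem_nhds]
  rintro _ ⟨x, rfl⟩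
  have h1 : φ ⟨x / 2, half_pos x.2⟩ < φ x := hφ (Subtype.mk_lt_mk.2 (half_lt_self x.2))
  have h2 : φ x < φ ⟨x + 1, by linarith [x.2]⟩ := hφ (Subtype.mk_lt_mk.2 (lt_add_one _))
  exact Filter.mem_of_superset (Icc_mem_nhds h1 h2)
    (hc.ordConnected.out (φ.mem_range _) (φ.mem_range _))

/-- A convex function is continuous on an open interval, so its image there is again an interval.
This places the mean of `ψ` in the range of `ψ` in part (ii). -/
theorem convex_range_of_convexOn {φ ψ : IndexFunction} (hφ : StrictMono φ)
    (h : ConvexOn ℝ φ.range fun y => (ψ (φ.inv y) : ℝ)) : Convex ℝ ψ.range := by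
  have himage : (fun y => (ψ (φ.inv y) : ℝ)) '' φ.range = ψ.range := by
    ext z
    constructor
    · rintro ⟨y, -, rfl⟩
      exact ψ.mem_range _
    · rintro ⟨x, rfl⟩
      exact ⟨φ x, φ.mem_range x, by simp only [inv_apply hφ.injective]⟩
  rw [← himage]
  exact (h.1.isPreconnected.image _ (h.continuousOn (isOpen_range hφ h.1))).convex

end IndexFunction

/-! ### The interpolation inequalities -/

theorem mainTheorem3 {𝕜 H : Type*} [RCLike 𝕜] [NormedAddCommGroup H] [InnerProductSpace 𝕜 H]
    [CompleteSpace H]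
    (T : H →ₗ.[𝕜] H) (hT : IsSelfAdjoint T)
    (hTpos : ∀ f : T.domain, (f : H) ≠ 0 → 0 < RCLike.re (inner 𝕜 (f : H) (T f)))
    (E : SpectralMeasure 𝕜 H) (hE : E.IsSpectralMeasureOf T)
    (φ ψ θ : IndexFunction) :
    (Function.Injective ψ → ConcaveOn ℝ ψ.range (fun y => (φ (ψ.inv y) : ℝ)) →
      ∀ f : E.Scale ((φ + ψ + 1) * θ), f ≠ 0 →
        0 < E.normIn θ (IndexFunction.le_weight_base φ ψ θ) f ^ 2 ∧
        E.normIn (ψ * θ) (IndexFunction.le_weight_right φ ψ θ) f ^ 2 /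
            E.normIn θ (IndexFunction.le_weight_base φ ψ θ) f ^ 2 ∈ ψ.range ∧
        E.normIn (φ * θ) (IndexFunction.le_weight_left φ ψ θ) f ^ 2 ≤
          E.normIn θ (IndexFunction.le_weight_base φ ψ θ) f ^ 2 *
            (φ (ψ.inv (E.normIn (ψ * θ) (IndexFunction.le_weight_right φ ψ θ) f ^ 2 /
              E.normIn θ (IndexFunction.le_weight_base φ ψ θ) f ^ 2)) : ℝ)) ∧
    (StrictMono φ → StrictMono ψ → ConvexOn ℝ φ.range (fun y => (ψ (φ.inv y) : ℝ)) →
      ∀ f : E.Scale ((φ + ψ + 1) * θ), f ≠ 0 →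
        0 < E.normIn θ (IndexFunction.le_weight_base φ ψ θ) f ^ 2 ∧
        E.normIn (φ * θ) (IndexFunction.le_weight_left φ ψ θ) f ^ 2 /
            E.normIn θ (IndexFunction.le_weight_base φ ψ θ) f ^ 2 ∈ φ.range ∧
        E.normIn (ψ * θ) (IndexFunction.le_weight_right φ ψ θ) f ^ 2 /
            E.normIn θ (IndexFunction.le_weight_base φ ψ θ) f ^ 2 ∈ ψ.range ∧
        φ.inv (E.normIn (φ * θ) (IndexFunction.le_weight_left φ ψ θ) f ^ 2 /
            E.normIn θ (IndexFunction.le_weight_base φ ψ θ) f ^ 2) ≤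
          ψ.inv (E.normIn (ψ * θ) (IndexFunction.le_weight_right φ ψ θ) f ^ 2 /
            E.normIn θ (IndexFunction.le_weight_base φ ψ θ) f ^ 2)) := by
  refine ⟨fun hψ hconc f hf => ?_, fun hφ hψ hconv f hf => ?_⟩
  · obtain ⟨hpos, ρ, hρ, hE⟩ :=
      E.exists_probabilityMeasure (IndexFunction.le_weight_base φ ψ θ) hf
    obtain ⟨hφi, hφe⟩ := hE φ (IndexFunction.le_weight_left φ ψ θ)
    obtain ⟨hψi, hψe⟩ := hE ψ (IndexFunction.le_weight_right φ ψ θ)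
    refine ⟨hpos, ?_, ?_⟩
    · rw [hψe]
      exact integral_mem_of_convex hψi hconc.1 ψ.mem_range
    · have h := hconc.neg.map_integral_le_integral_real hψi ψ.mem_range
        (by simp only [Pi.neg_apply, IndexFunction.inv_apply hψ]; exact hφi.neg)
      simp only [Pi.neg_apply, IndexFunction.inv_apply hψ, integral_neg, neg_le_neg_iff] at h
      rw [← div_le_iff₀' hpos, hφe, hψe]
      exact h
  · obtain ⟨hpos, ρ, hρ, hE⟩ :=
      E.exists_probabilityMeasure (IndexFunction.le_weight_base φ ψ θ) hf
    obtain ⟨hφi, hφe⟩ := hE φ (IndexFunction.le_weight_left φ ψ θ)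
    obtain ⟨hψi, hψe⟩ := hE ψ (IndexFunction.le_weight_right φ ψ θ)
    have hψmem : ∫ x, (ψ x : ℝ) ∂ρ ∈ ψ.range :=
      integral_mem_of_convex hψi (IndexFunction.convex_range_of_convexOn hφ hconv) ψ.mem_range
    have h := hconv.map_integral_le_integral_real hφi φ.mem_range
      (by simpa only [IndexFunction.inv_apply hφ.injective] using hψi)
    simp only [IndexFunction.inv_apply hφ.injective] at h
    rw [hφe, hψe]
    refine ⟨hpos, integral_mem_of_convex hφi hconv.1 φ.mem_range, hψmem, hψ.le_iff_le.1 ?_⟩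
    -- Writing the mean of `ψ` as a value of `ψ` puts Jensen's inequality in the form `ψ a ≤ ψ b`.
    rw [← IndexFunction.apply_inv hψmem] at h
    exact h
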